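/- Let $\mu$ be a probability measure on the unit circle $\{|z|=1\}$ that is nontrivial (not supported on a finite set), let $\Phi_n$ be its monic orthogonal polynomials, and let $(\alpha_n)_{n\ge 0}$ be its Verblunsky coefficients, i.e. the complex numbers with $$\Phi_0=1,\qquad \Phi_{n+1}(z)=z\Phi_n(z)-\bar\alpha_n\Phi_n^*(z),\qquad \Phi_n^*(z)=z^n\,\overline{\Phi_n(1/\bar z)} .$$ Write $d\mu=w(\theta)\,\frac{d\theta}{2\pi}+d\mu_s$ with $\mu_s$ singular. When $w>0$ a.e. and $\log w$ is integrable (the Szegő condition), the Szegő function of $\mu$ is $$D(z)=\exp\Bigl(\frac1{4\pi}\int_0^{2\pi}\frac{e^{i\theta}+z}{e^{i\theta}-z}\,\log w(\theta)\,d\theta\Bigr),\qquad |z|<1 .$$ Let $b\in(0,1)$, let $p\ge 1$, and let $c_1,\dots,c_p\in\mathbb C$, extended $p$-periodically to all integer indices, satisfy $\prod_{j=1}^p c_j=1$. Suppose that $$\lim_{m\to\infty}\frac{\alpha_{mp+\ell}}{\alpha_{mp+\ell-1}}=b\,c_\ell,\qquad \ell=1,\dots,p$$ (in particular $\alpha_n\ne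 0$ for all large $n$). Then the Szegő condition holds, and for every $\ell=1,\dots,p$ and every $\varepsilon>0$, $$\lim_{m\to\infty}\frac{\Phi_{mp+\ell}(z)}{\bar\alpha_{mp+\ell-1}}=-D(0)\,D(z)^{-1}\,G_\ell(z)\qquad\text{uniformly on } \{|z|<b-\varepsilon\},$$ where $G_\ell$ is the rational function determined by $$G_\ell(z)\Bigl(1-\frac{z^p}{b^p}\Bigr)=\sum_{k=0}^{p-1}\Bigl(\prod_{j=1}^{k}(b\,\bar c_{\ell-j})^{-1}\Bigr)z^k .$$ -/

import Mathlib

open Polynomial MeasureTheory Filter Topology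
open scoped ComplexConjugate

namespace OPUC

noncomputable section

/-- The circle `ℝ / 2πℤ` of angles has positive length. -/
instance instFactTwoPiPos : Fact ((0 : ℝ) < 2 * Real.pi) := ⟨Real.two_pi_pos⟩

/-- The circle of angles `θ`; it is identified with the unit circle of `ℂ` through
`θ ↦ e^{iθ}`. Measures on the unit circle are measures on this space. -/
abbrev Angle : Type := AddCircle (2 * Real.pi)

/-- The point `e^{iθ}` of the unit circle. -/
def pt (θ : Angle) : ℂ := (AddCircle.toCircle θ : ℂ)

/-- Normalized arc length `dθ / 2π`. -/
abbrev arc : Measure Angle := AddCircle.haarAddCircle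

/-- A measure on the unit circle is nontrivial if it is not carried by a finite set. -/
def IsNontrivial (μ : Measure Angle) : Prop :=
  ∀ s : Set Angle, s.Finite → μ sᶜ ≠ 0

/-- The reversed polynomial `P^*(z) = z^n * conj (P (1 / conj z))` of a polynomial `P` of degree
at most `n`: the coefficient of `z^i` in `P^*` is the conjugate of that of `z^(n-i)` in `P`. -/
def rev (n : ℕ) (P : ℂ[X]) : ℂ[X] := (P.map (starRingEnd ℂ)).reflect n

/-- The polynomials given by the Szegő recursion with coefficients `α`:
`Φ_0 = 1` and `Φ_{n+1}(z) = z Φ_n(z) - conj α_n Φ_n^*(z)`. -/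
def Phi (α : ℕ → ℂ) : ℕ → ℂ[X]
  | 0 => 1
  | n + 1 => X * Phi α n - C (conj (α n)) * rev n (Phi α n)

/-- `Q` is the sequence of monic orthogonal polynomials of the measure `μ`. -/
def IsMonicOrthogonal (μ : Measure Angle) (Q : ℕ → ℂ[X]) : Prop :=
  ∀ n, (Q n).Monic ∧ (Q n).natDegree = n ∧
    ∀ j < n, ∫ θ, conj (pt θ ^ j) * (Q n).eval (pt θ) ∂μ = 0

/-- `α` is the sequence of Verblunsky coefficients of `μ`: the Szegő recursion with
coefficients `α` produces the monic orthogonal polynomials of `μ`. -/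
def IsVerblunsky (μ : Measure Angle) (α : ℕ → ℂ) : Prop :=
  IsMonicOrthogonal μ (Phi α)

/-- The density `w` in the Lebesgue decomposition `dμ = w dθ/2π + dμ_s`. -/
def weight (μ : Measure Angle) (θ : Angle) : ℝ := (μ.rnDeriv arc θ).toReal

/-- The Szegő condition `∫ log w dθ/2π > -∞`: `w` is positive almost everywhere
and `log w` is integrable. -/
def SzegoCondition (μ : Measure Angle) : Prop :=
  (∀ᵐ θ ∂arc, 0 < weight μ θ) ∧ Integrable (fun θ => Real.log (weight μ θ)) arc

/-- The Szegő function, for `‖z‖ < 1`: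
`D(z) = exp ((1/4π) ∫ (e^{iθ} + z) / (e^{iθ} - z) * log w(θ) dθ)`. -/
def szegoD (μ : Measure Angle) (z : ℂ) : ℂ :=
  Complex.exp ((1 / 2 : ℂ) *
    ∫ θ, (pt θ + z) / (pt θ - z) * (Real.log (weight μ θ) : ℂ) ∂arc)

/-- The rational function `G_ℓ` determined by `b` and the `p`-periodic sequence `c`:
`G_ℓ(z) (1 - z^p/b^p) = ∑_{k=0}^{p-1} (∏_{j=1}^k (b conj c_{ℓ-j})⁻¹) z^k`. -/
def G (p : ℕ) (b : ℝ) (c : ZMod p → ℂ) (ℓ : ℕ) (z : ℂ) : ℂ :=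
  (∑ k ∈ Finset.range p,
      (∏ j ∈ Finset.Icc 1 k, ((b : ℂ) * conj (c ((ℓ : ZMod p) - (j : ZMod p))))⁻¹) * z ^ k) /
    (1 - z ^ p / (b : ℂ) ^ p)

end

end OPUC

namespace OPUC

/-! ### The Szegő recursion -/

section Recursion

variable (α : ℕ → ℂ)

theorem natDegree_rev_le {n : ℕ} {P : ℂ[X]} (hP : P.natDegree ≤ n) : (rev n P).natDegree ≤ n := by
  refine natDegree_reflect_le.trans ?_
  rw [natDegree_map]
  exact max_le le_rfl hP

theorem natDegree_Phi_le (n : ℕ) : (Phi α n).natDegree ≤ n := by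
  induction n with
  | zero => simp [Phi]
  | succ n ih =>
    refine (natDegree_sub_le _ _).trans (max_le ?_ ?_)
    · refine natDegree_mul_le.trans ?_
      rw [natDegree_X]
      omega
    · exact (natDegree_C_mul_le _ _).trans ((natDegree_rev_le ih).trans (Nat.le_succ n))

theorem map_conj_map_conj (P : ℂ[X]) :
    (P.map (starRingEnd ℂ)).map (starRingEnd ℂ) = P := by
  ext; simp

theorem rev_Phi_succ (n : ℕ) :
    rev (n + 1) (Phi α (n + 1)) = rev n (Phi α n) - C (α n) * (X * Phi α n) := by
  have hd : ((Phi α n).map (starRingEnd ℂ)).natDegree ≤ n := by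
    rw [natDegree_map]; exact natDegree_Phi_le α n
  have h1 : reflect (n + 1) (X * (Phi α n).map (starRingEnd ℂ)) =
      reflect n ((Phi α n).map (starRingEnd ℂ)) := by
    rw [add_comm n 1, reflect_mul _ _ natDegree_X_le hd, reflect_one_X, one_mul]
  have h2 : reflect (n + 1) (reflect n (Phi α n)) = X * Phi α n := by
    have h3 : (reflect n (Phi α n)).natDegree ≤ n :=
      natDegree_reflect_le.trans (max_le le_rfl (natDegree_Phi_le α n))
    have := reflect_mul (1 : ℂ[X]) (reflect n (Phi α n)) (F := 1) (by simp) h3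
    rwa [one_mul, reflect_one, pow_one, reflect_reflect, add_comm 1 n] at this
  simp only [rev, Phi, Polynomial.map_sub, Polynomial.map_mul, map_X, map_C, reflect_sub,
    reflect_C_mul, Complex.conj_conj, h1, reflect_map, map_conj_map_conj, h2]

theorem eval_Phi_succ (n : ℕ) (z : ℂ) : (Phi α (n + 1)).eval z =
    z * (Phi α n).eval z - conj (α n) * (rev n (Phi α n)).eval z := by
  simp [Phi]

theorem eval_rev_Phi_succ (n : ℕ) (z : ℂ) : (rev (n + 1) (Phi α (n + 1))).eval z =
    (rev n (Phi α n)).eval z - α n * (z * (Phi α n).eval z) := by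
  simp [rev_Phi_succ]

theorem rev_Phi_zero : rev 0 (Phi α 0) = 1 := by
  simp [rev, Phi]

theorem eval_rev_Phi_zero_right (n : ℕ) : (rev n (Phi α n)).eval 0 = 1 := by
  induction n with
  | zero => simp [rev_Phi_zero]
  | succ n ih => simp [eval_rev_Phi_succ, ih]

/-- On the unit circle the reversed polynomial is `z ^ n * conj (P z)`. -/
theorem eval_rev_of_norm_eq_one {n : ℕ} {P : ℂ[X]} (hP : P.natDegree ≤ n) {z : ℂ} (hz : ‖z‖ = 1) :
    (rev n P).eval z = z ^ n * conj (P.eval z) := by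
  have hz0 : z ≠ 0 := fun h => by simp [h] at hz
  have hcz : conj z = z⁻¹ := (Complex.inv_eq_conj hz).symm
  let _ : Invertible (conj z) := invertibleOfNonzero (by simpa using hz0)
  have h := eval₂_reflect_mul_pow (RingHom.id ℂ) (conj z) n (P.map (starRingEnd ℂ))
    (by rwa [natDegree_map])
  rw [invOf_eq_inv, hcz, inv_inv] at h
  have h' : (rev n P).eval z * z⁻¹ ^ n = conj (P.eval z) := by
    rw [← hcz, ← eval₂_at_apply, ← eval_map, hcz]
    simpa only [rev, eval₂_id] using h
  rw [← h', mul_comm, mul_assoc, ← mul_pow, inv_mul_cancel₀ hz0, one_pow, mul_one]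

theorem norm_eval_Phi_le (hα : ∀ n, ‖α n‖ ≤ 1) (n : ℕ) {z : ℂ} (hz : ‖z‖ ≤ 1) :
    ‖(Phi α n).eval z‖ ≤ ‖(rev n (Phi α n)).eval z‖ := by
  induction n with
  | zero => rw [rev_Phi_zero, Phi]
  | succ n ih =>
    have key : ∀ a u v : ℂ, ‖v - a * u‖ ^ 2 - ‖u - conj a * v‖ ^ 2 =
        (1 - ‖a‖ ^ 2) * (‖v‖ ^ 2 - ‖u‖ ^ 2) := by
      intro a u v
      simp only [← Complex.normSq_eq_norm_sq, Complex.normSq_apply, Complex.sub_re, Complex.sub_im,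
        Complex.mul_re, Complex.mul_im, Complex.conj_re, Complex.conj_im]
      ring
    rw [eval_Phi_succ, eval_rev_Phi_succ]
    have h1 := key (α n) (z * (Phi α n).eval z) ((rev n (Phi α n)).eval z)
    have h2 : ‖z * (Phi α n).eval z‖ ≤ ‖(rev n (Phi α n)).eval z‖ := by
      rw [norm_mul]
      exact (mul_le_of_le_one_left (norm_nonneg _) hz).trans ih
    have h3 : 0 ≤ (1 - ‖α n‖ ^ 2) *
        (‖(rev n (Phi α n)).eval z‖ ^ 2 - ‖z * (Phi α n).eval z‖ ^ 2) := by
      apply mul_nonneg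
      · nlinarith [hα n, norm_nonneg (α n)]
      · nlinarith [norm_nonneg (z * (Phi α n).eval z)]
    exact abs_le_of_sq_le_sq' (by linarith) (norm_nonneg _) |>.2

end Recursion

theorem eval_rev_Phi_ne_zero_and_norm_le {α : ℕ → ℂ} (hα : ∀ n, ‖α n‖ < 1) {z : ℂ} (hz : ‖z‖ ≤ 1)
    (n : ℕ) : (rev n (Phi α n)).eval z ≠ 0 ∧
      ‖-(α n * (z * (Phi α n).eval z / (rev n (Phi α n)).eval z))‖ ≤ ‖α n‖ := by
  have hle := fun n => norm_eval_Phi_le α (fun n => (hα n).le) n hz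
  have hb : ∀ n, ‖-(α n * (z * (Phi α n).eval z / (rev n (Phi α n)).eval z))‖ ≤ ‖α n‖ := by
    intro n
    rw [norm_neg, norm_mul, norm_div, norm_mul]
    refine mul_le_of_le_one_right (norm_nonneg _) (div_le_one_of_le₀ ?_ (norm_nonneg _))
    exact (mul_le_of_le_one_left (norm_nonneg _) hz).trans (hle n)
  refine ⟨?_, hb n⟩
  induction n with
  | zero => simp [rev_Phi_zero]
  | succ n ih =>
    rw [eval_rev_Phi_succ]
    intro h
    have h1 : -(α n * (z * (Phi α n).eval z / (rev n (Phi α n)).eval z)) = -1 := by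
      rw [← mul_div_assoc, ← sub_eq_zero.mp h, div_self ih]
    have h2 := hb n
    rw [h1, norm_neg, norm_one] at h2
    exact absurd (hα n) (not_lt.mpr h2)

/-- If the coefficients are summable, the reversed polynomials converge uniformly on the closed
unit disc to a zero-free function, the exponential of a function in the disc algebra. -/
theorem exists_log_limit_rev_Phi {α : ℕ → ℂ} (hα : ∀ n, ‖α n‖ < 1)
    (hs : Summable fun n => ‖α n‖) :
    ∃ F : ℂ → ℂ, DiffContOnCl ℂ F (Metric.ball 0 1) ∧ F 0 = 0 ∧
      TendstoUniformlyOn (fun n z => (rev n (Phi α n)).eval z) (fun z => Complex.exp (F z)) atTop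
        (Metric.closedBall 0 1) := by
  set w : ℕ → ℂ → ℂ := fun n z =>
    -(α n * (z * (Phi α n).eval z / (rev n (Phi α n)).eval z)) with hw
  have hmem : ∀ {z : ℂ}, z ∈ Metric.closedBall (0 : ℂ) 1 → ‖z‖ ≤ 1 := fun h => by simpa using h
  have hne : ∀ n, ∀ z ∈ Metric.closedBall (0 : ℂ) 1, (rev n (Phi α n)).eval z ≠ 0 :=
    fun n z hz => (eval_rev_Phi_ne_zero_and_norm_le hα (hmem hz) n).1
  have hwb : ∀ n, ∀ z ∈ Metric.closedBall (0 : ℂ) 1, ‖w n z‖ ≤ ‖α n‖ :=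
    fun n z hz => (eval_rev_Phi_ne_zero_and_norm_le hα (hmem hz) n).2
  have hslit : ∀ n, ∀ z ∈ Metric.closedBall (0 : ℂ) 1, 1 + w n z ∈ Complex.slitPlane :=
    fun n z hz => Complex.mem_slitPlane_of_norm_lt_one ((hwb n z hz).trans_lt (hα n))
  have hunif : TendstoUniformlyOn (fun n z => ∑ k ∈ Finset.range n, Complex.log (1 + w k z))
      (fun z => ∑' k, Complex.log (1 + w k z)) atTop (Metric.closedBall 0 1) :=
    (hs.hasSumUniformlyOn_log_one_add (.of_forall hwb)).tendstoUniformlyOn_finsetRange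
  have hprod : ∀ n, ∀ z ∈ Metric.closedBall (0 : ℂ) 1,
      Complex.exp (∑ k ∈ Finset.range n, Complex.log (1 + w k z)) =
        (rev n (Phi α n)).eval z := by
    intro n z hz
    induction n with
    | zero => simp [rev_Phi_zero]
    | succ n ih =>
      rw [Finset.sum_range_succ, Complex.exp_add, ih,
        Complex.exp_log (Complex.slitPlane_ne_zero (hslit n z hz)), eval_rev_Phi_succ, hw]
      have := hne n z hz
      field_simp
      ring
  have hdc : ∀ n, ContinuousOn (fun z => ∑ k ∈ Finset.range n, Complex.log (1 + w k z))
      (Metric.closedBall 0 1) := by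
    intro n
    refine continuousOn_finsetSum _ fun k _ => ContinuousOn.clog ?_ (hslit k)
    refine continuousOn_const.add (continuousOn_const.mul (ContinuousOn.div ?_ ?_ (hne k))).neg
    · exact (continuous_id.mul (Phi α k).continuous).continuousOn
    · exact (rev k (Phi α k)).continuous.continuousOn
  have hdd : ∀ n, DifferentiableOn ℂ (fun z => ∑ k ∈ Finset.range n, Complex.log (1 + w k z))
      (Metric.ball 0 1) := by
    intro n
    refine DifferentiableOn.fun_sum fun k _ => DifferentiableOn.clog ?_
      (fun z hz => hslit k z (Metric.ball_subset_closedBall hz))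
    refine (((DifferentiableOn.div ?_ ?_ ?_).const_mul (α k)).neg).const_add 1
    · exact (differentiable_id.mul (Phi α k).differentiable).differentiableOn
    · exact (rev k (Phi α k)).differentiable.differentiableOn
    · exact fun z hz => hne k z (Metric.ball_subset_closedBall hz)
  have hFc : ContinuousOn (fun z => ∑' k, Complex.log (1 + w k z)) (Metric.closedBall 0 1) :=
    hunif.continuousOn (Frequently.of_forall hdc)
  refine ⟨fun z => ∑' k, Complex.log (1 + w k z), ⟨?_, ?_⟩, by simp [hw], ?_⟩
  · exact (hunif.mono Metric.ball_subset_closedBall).tendstoLocallyUniformlyOn.differentiableOn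
      (.of_forall hdd) Metric.isOpen_ball
  · rwa [closure_ball _ one_ne_zero]
  · refine (hunif.comp_cexp ?_).congr (.of_forall fun n z hz => hprod n z hz)
    exact ((isCompact_closedBall (0 : ℂ) 1).image_of_continuousOn
      (Complex.continuous_re.comp_continuousOn hFc)).bddAbove

/-! ### The unit circle -/

@[simp] theorem norm_pt (θ : Angle) : ‖pt θ‖ = 1 := Circle.norm_coe _

theorem continuous_pt : Continuous pt :=
  continuous_subtype_val.comp AddCircle.continuous_toCircle

theorem pt_injective : Function.Injective pt :=
  Circle.coe_injective.comp (AddCircle.injective_toCircle (Real.two_pi_pos.ne'))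

theorem pt_mem_closedBall (θ : Angle) : pt θ ∈ Metric.closedBall (0 : ℂ) 1 := by simp

theorem continuous_eval_pt (P : ℂ[X]) : Continuous fun θ => P.eval (pt θ) :=
  P.continuous.comp continuous_pt

theorem continuous_conj_eval_pt (P : ℂ[X]) : Continuous fun θ => conj (P.eval (pt θ)) :=
  Complex.continuous_conj.comp (continuous_eval_pt P)

theorem integrable_of_continuous (μ : Measure Angle) [IsFiniteMeasure μ] {E : Type*}
    [NormedAddCommGroup E] {f : Angle → E} (hf : Continuous f) : Integrable f μ :=
  hf.integrable_of_hasCompactSupport (HasCompactSupport.of_compactSpace f)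

theorem tendsto_integral_mul_of_tendstoUniformly (μ : Measure Angle) [IsFiniteMeasure μ]
    {f : ℕ → Angle → ℂ} {g h : Angle → ℂ} (hf : ∀ n, Continuous (f n)) (hg : Continuous g)
    (hh : Continuous h) (hfg : TendstoUniformly f g atTop) :
    Tendsto (fun n => ∫ θ, h θ * f n θ ∂μ) atTop (𝓝 (∫ θ, h θ * g θ ∂μ)) := by
  refine tendsto_integral_filter_of_dominated_convergence (fun θ => ‖h θ‖ * (‖g θ‖ + 1)) ?_ ?_ ?_ ?_
  · exact .of_forall fun n => (hh.mul (hf n)).aestronglyMeasurable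
  · filter_upwards [Metric.tendstoUniformly_iff.mp hfg 1 one_pos] with n hn
    refine .of_forall fun θ => ?_
    rw [norm_mul]
    gcongr
    have h1 := hn θ
    rw [dist_eq_norm] at h1
    have h2 := norm_sub_norm_le (f n θ) (g θ)
    rw [norm_sub_rev] at h2
    linarith
  · exact integrable_of_continuous μ (hh.norm.mul (hg.norm.add continuous_const))
  · exact .of_forall fun θ => (hfg.tendsto_at θ).const_mul _

/-! ### Orthogonality -/

section Orthogonality

variable {μ : Measure Angle} [IsFiniteMeasure μ] {α : ℕ → ℂ}

theorem integral_conj_eval_mul (μ : Measure Angle) [IsFiniteMeasure μ] {f : Angle → ℂ}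
    (hf : Continuous f) {n : ℕ} {q : ℂ[X]} (hq : q.natDegree ≤ n) :
    ∫ θ, conj (q.eval (pt θ)) * f θ ∂μ =
      ∑ j ∈ Finset.range (n + 1), conj (q.coeff j) * ∫ θ, conj (pt θ ^ j) * f θ ∂μ := by
  simp_rw [← integral_const_mul]
  rw [← integral_finsetSum]
  · refine integral_congr_ae (.of_forall fun θ => ?_)
    simp only [eval_eq_sum_range' (Nat.lt_succ_of_le hq), map_sum, map_mul, Finset.sum_mul,
      mul_assoc]
  · intro j _
    refine integrable_of_continuous μ (continuous_const.mul (Continuous.mul ?_ hf))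
    exact Complex.continuous_conj.comp (continuous_pt.pow j)

theorem IsVerblunsky.integral_conj_mul_Phi (h : IsVerblunsky μ α) {n : ℕ} {q : ℂ[X]}
    (hq : q.natDegree ≤ n) :
    ∫ θ, conj (q.eval (pt θ)) * (Phi α (n + 1)).eval (pt θ) ∂μ = 0 := by
  rw [integral_conj_eval_mul μ (continuous_eval_pt _) hq]
  refine Finset.sum_eq_zero fun j hj => ?_
  rw [(h (n + 1)).2.2 j (Finset.mem_range.mp hj), mul_zero]

theorem IsVerblunsky.integral_conj_mul_rev_Phi (h : IsVerblunsky μ α) {n : ℕ} {q : ℂ[X]}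
    (hq : q.natDegree ≤ n) :
    ∫ θ, conj (q.eval (pt θ)) * (rev n (Phi α n)).eval (pt θ) ∂μ =
      conj (q.eval 0) * ∫ θ, (rev n (Phi α n)).eval (pt θ) ∂μ := by
  rw [integral_conj_eval_mul μ (continuous_eval_pt _) hq, Finset.sum_eq_single 0]
  · simp [coeff_zero_eq_eval_zero]
  · intro j hj hj0
    have hjn : j ≤ n := Nat.lt_succ_iff.mp (Finset.mem_range.mp hj)
    have h1 : ∀ θ, conj (pt θ ^ j) * (rev n (Phi α n)).eval (pt θ) =
        conj (conj (pt θ ^ (n - j)) * (Phi α n).eval (pt θ)) := by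
      intro θ
      rw [eval_rev_of_norm_eq_one (natDegree_Phi_le α n) (norm_pt θ), map_mul, Complex.conj_conj,
        ← mul_assoc]
      congr 1
      have h2 : conj (pt θ) * pt θ = 1 := by
        rw [Complex.conj_mul', norm_pt]; simp
      conv_lhs => rw [← Nat.sub_add_cancel hjn, pow_add, mul_comm, mul_assoc, map_pow,
        mul_comm (pt θ ^ j), ← mul_pow, h2, one_pow, mul_one]
    simp_rw [h1]
    rw [integral_conj, (h n).2.2 (n - j) (by omega), map_zero, mul_zero]
  · simp

theorem norm_eval_rev_Phi_pt (n : ℕ) (θ : Angle) :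
    ‖(rev n (Phi α n)).eval (pt θ)‖ = ‖(Phi α n).eval (pt θ)‖ := by
  rw [eval_rev_of_norm_eq_one (natDegree_Phi_le α n) (norm_pt θ)]
  simp

theorem IsVerblunsky.integral_norm_sq_Phi_succ (h : IsVerblunsky μ α) (n : ℕ) :
    ∫ θ, ‖(Phi α (n + 1)).eval (pt θ)‖ ^ 2 ∂μ =
      (1 - ‖α n‖ ^ 2) * ∫ θ, ‖(Phi α n).eval (pt θ)‖ ^ 2 ∂μ := by
  have hpt : ∀ θ, (1 - ‖α n‖ ^ 2) * ‖(Phi α n).eval (pt θ)‖ ^ 2 =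
      ‖(Phi α (n + 1)).eval (pt θ)‖ ^ 2 + 2 * RCLike.re (α n *
        (conj ((rev n (Phi α n)).eval (pt θ)) * (Phi α (n + 1)).eval (pt θ))) := by
    intro θ
    have key : ∀ a u v : ℂ, ‖u‖ ^ 2 = ‖u - conj a * v‖ ^ 2 + ‖a‖ ^ 2 * ‖v‖ ^ 2 +
        2 * (a * (conj v * (u - conj a * v))).re := by
      intro a u v
      simp only [← Complex.normSq_eq_norm_sq, Complex.normSq_apply, Complex.sub_re, Complex.sub_im,
        Complex.mul_re, Complex.mul_im, Complex.conj_re, Complex.conj_im]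
      ring
    have h1 := key (α n) (pt θ * (Phi α n).eval (pt θ)) ((rev n (Phi α n)).eval (pt θ))
    rw [← eval_Phi_succ, norm_eval_rev_Phi_pt, norm_mul, norm_pt, one_mul] at h1
    rw [RCLike.re_eq_complex_re]
    linarith
  have hi : Integrable (fun θ => α n *
      (conj ((rev n (Phi α n)).eval (pt θ)) * (Phi α (n + 1)).eval (pt θ))) μ :=
    integrable_of_continuous μ (continuous_const.mul
      ((continuous_conj_eval_pt _).mul (continuous_eval_pt _)))
  rw [← integral_const_mul]
  simp_rw [hpt]
  rw [integral_add, integral_const_mul, integral_re hi, integral_const_mul,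
    h.integral_conj_mul_Phi (natDegree_rev_le (natDegree_Phi_le α n))]
  · simp
  · exact integrable_of_continuous μ ((continuous_eval_pt _).norm.pow 2)
  · exact hi.re.const_mul 2

theorem integral_norm_sq_eval_pos (hμ : IsNontrivial μ) {P : ℂ[X]} (hP : P ≠ 0) :
    0 < ∫ θ, ‖P.eval (pt θ)‖ ^ 2 ∂μ := by
  refine lt_of_le_of_ne (integral_nonneg fun θ => by positivity) fun h => ?_
  have hi : Integrable (fun θ => ‖P.eval (pt θ)‖ ^ 2) μ :=
    integrable_of_continuous μ ((continuous_eval_pt P).norm.pow 2)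
  rw [eq_comm, integral_eq_zero_iff_of_nonneg (fun θ => by positivity) hi] at h
  refine hμ (pt ⁻¹' {z | P.IsRoot z}) ((finite_setOfPred_isRoot hP).preimage pt_injective.injOn) ?_
  rw [Filter.EventuallyEq, ae_iff] at h
  simpa [Set.compl_def] using h

theorem IsVerblunsky.norm_lt_one (h : IsVerblunsky μ α) (hμ : IsNontrivial μ) (n : ℕ) :
    ‖α n‖ < 1 := by
  have h1 := integral_norm_sq_eval_pos hμ (h (n + 1)).1.ne_zero
  have h2 := integral_norm_sq_eval_pos hμ (h n).1.ne_zero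
  rw [h.integral_norm_sq_Phi_succ] at h1
  have h3 := (pos_iff_pos_of_mul_pos h1).mpr h2
  nlinarith [norm_nonneg (α n)]

end Orthogonality

/-! ### Integrals against arc length -/

theorem integral_arc_eq_circleAverage {E : Type*} [NormedAddCommGroup E] [NormedSpace ℝ E]
    (f : ℂ → E) : ∫ θ, f (pt θ) ∂arc = Real.circleAverage f 0 1 := by
  rw [AddCircle.integral_haarAddCircle, Real.circleAverage,
    ← AddCircle.intervalIntegral_preimage (2 * Real.pi) 0, zero_add]
  congr 1
  refine intervalIntegral.integral_congr fun t _ => ?_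
  simp only [pt, AddCircle.toCircle_apply_mk, circleMap, Circle.coe_exp]
  congr 1
  have := Real.two_pi_pos.ne'
  simp [this]

theorem integral_arc_of_diffContOnCl {f : ℂ → ℂ} (hf : DiffContOnCl ℂ f (Metric.ball 0 1)) :
    ∫ θ, f (pt θ) ∂arc = f 0 := by
  rw [integral_arc_eq_circleAverage]
  exact DiffContOnCl.circleAverage (by rwa [abs_one])

theorem integral_arc_conj_pow (j : ℕ) :
    ∫ θ, conj (pt θ ^ j) ∂arc = if j = 0 then 1 else 0 := by
  rw [integral_conj, integral_arc_of_diffContOnCl (f := fun z => z ^ j)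
    (differentiable_id.pow j).diffContOnCl]
  split_ifs with h <;> simp [h]

theorem pt_sub_ne_zero {z : ℂ} (hz : ‖z‖ < 1) (θ : Angle) : pt θ - z ≠ 0 := by
  intro h
  rw [← sub_eq_zero.mp h, norm_pt] at hz
  exact lt_irrefl _ hz

theorem continuous_comp_pt {f : ℂ → ℂ} (hf : DiffContOnCl ℂ f (Metric.ball 0 1)) :
    Continuous fun θ => f (pt θ) := by
  have h := hf.continuousOn
  rw [closure_ball _ one_ne_zero] at h
  exact h.comp_continuous continuous_pt pt_mem_closedBall

theorem continuous_herglotz {z : ℂ} (hz : ‖z‖ < 1) :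
    Continuous fun θ => (pt θ + z) / (pt θ - z) :=
  (continuous_pt.add continuous_const).div (continuous_pt.sub continuous_const)
    (pt_sub_ne_zero hz)

theorem integral_herglotz_mul {f : ℂ → ℂ} (hf : DiffContOnCl ℂ f (Metric.ball 0 1)) {z : ℂ}
    (hz : ‖z‖ < 1) :
    ∫ θ, (pt θ + z) / (pt θ - z) * f (pt θ) ∂arc = 2 * f z - f 0 := by
  have h1 : ∫ θ, pt θ / (pt θ - z) * f (pt θ) ∂arc = f z := by
    have := DiffContOnCl.circleAverage_smul_div (f := f) (c := 0) (R := 1) (w := z)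
      (by rwa [abs_one]) (by simpa using hz)
    rw [← integral_arc_eq_circleAverage (fun ζ => ((ζ - 0) / (ζ - z)) • f ζ)] at this
    simpa using this
  have h2 : ∀ θ, (pt θ + z) / (pt θ - z) * f (pt θ) =
      2 * (pt θ / (pt θ - z) * f (pt θ)) - f (pt θ) := by
    intro θ
    have := pt_sub_ne_zero hz θ
    field_simp
    ring
  simp_rw [h2]
  rw [integral_sub, integral_const_mul, h1, integral_arc_of_diffContOnCl hf]
  · refine integrable_of_continuous _ (continuous_const.mul (Continuous.mul ?_
      (continuous_comp_pt hf)))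
    exact continuous_pt.div (continuous_pt.sub continuous_const) (pt_sub_ne_zero hz)
  · exact integrable_of_continuous _ (continuous_comp_pt hf)

theorem integral_herglotz_mul_conj {f : ℂ → ℂ} (hf : DiffContOnCl ℂ f (Metric.ball 0 1)) {z : ℂ}
    (hz : ‖z‖ < 1) :
    ∫ θ, (pt θ + z) / (pt θ - z) * conj (f (pt θ)) ∂arc = conj (f 0) := by
  have hden : ∀ ζ : ℂ, ‖ζ‖ ≤ 1 → 1 - conj z * ζ ≠ 0 := by
    intro ζ hζ h
    have h1 : ‖conj z * ζ‖ < 1 := by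
      rw [norm_mul, RCLike.norm_conj]
      exact (mul_le_of_le_one_right (norm_nonneg _) hζ).trans_lt hz
    rw [← sub_eq_zero.mp h, norm_one] at h1
    exact lt_irrefl _ h1
  have hk : DiffContOnCl ℂ (fun ζ : ℂ => (1 + conj z * ζ) / (1 - conj z * ζ))
      (Metric.ball 0 1) := by
    refine DifferentiableOn.diffContOnCl ?_
    rw [closure_ball _ one_ne_zero]
    refine DifferentiableOn.div (by fun_prop) (by fun_prop) fun ζ hζ => hden ζ (by simpa using hζ)
  have h1 : ∀ θ, (pt θ + z) / (pt θ - z) * conj (f (pt θ)) =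
      conj ((1 + conj z * pt θ) / (1 - conj z * pt θ) * f (pt θ)) := by
    intro θ
    have h2 : conj (pt θ) = (pt θ)⁻¹ := (Complex.inv_eq_conj (norm_pt θ)).symm
    have h3 : pt θ ≠ 0 := fun h => by simpa [h] using norm_pt θ
    have h4 : 1 - z * (pt θ)⁻¹ ≠ 0 := by
      have := hden (pt θ) (norm_pt θ).le
      have h5 := (map_ne_zero (starRingEnd ℂ)).mpr this
      simpa [h2] using h5
    have h5 := pt_sub_ne_zero hz θ
    simp only [map_mul, map_div₀, map_add, map_sub, map_one, Complex.conj_conj, h2]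
    congr 1
    field_simp
  simp_rw [h1]
  rw [integral_conj, integral_arc_of_diffContOnCl
    (f := fun ζ => (1 + conj z * ζ) / (1 - conj z * ζ) * f ζ) (hk.smul hf)]
  simp

/-- The Schwarz integral formula. -/
theorem integral_herglotz_mul_re {f : ℂ → ℂ} (hf : DiffContOnCl ℂ f (Metric.ball 0 1)) {z : ℂ}
    (hz : ‖z‖ < 1) :
    ∫ θ, (pt θ + z) / (pt θ - z) * (2 * (f (pt θ)).re : ℂ) ∂arc =
      2 * f z - f 0 + conj (f 0) := by
  rw [← integral_herglotz_mul hf hz, ← integral_herglotz_mul_conj hf hz, ← integral_add]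
  · refine integral_congr_ae (.of_forall fun θ => ?_)
    simp only
    rw [← mul_add, Complex.add_conj]
    push_cast
    rfl
  · exact integrable_of_continuous _ ((continuous_herglotz hz).mul (continuous_comp_pt hf))
  · exact integrable_of_continuous _ ((continuous_herglotz hz).mul
      (Complex.continuous_conj.comp (continuous_comp_pt hf)))

/-! ### Determination of a measure by its moments -/

theorem measure_ext_of_moments {μ ν : Measure Angle} [IsFiniteMeasure μ] [IsFiniteMeasure ν]
    (h : ∀ j : ℕ, ∫ θ, conj (pt θ ^ j) ∂μ = ∫ θ, conj (pt θ ^ j) ∂ν) : μ = ν := by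
  have hpow : ∀ (j : ℕ) (θ : Angle), fourier (j : ℤ) θ = pt θ ^ j := by
    intro j θ
    rw [fourier_apply, AddCircle.toCircle_zsmul]
    simp [pt]
  have hneg : ∀ j : ℕ, ∫ θ, fourier (-(j : ℤ)) θ ∂μ = ∫ θ, fourier (-(j : ℤ)) θ ∂ν := by
    intro j
    simp_rw [fourier_neg, hpow]
    exact h j
  have hfour : ∀ n : ℤ, ∫ θ, fourier n θ ∂μ = ∫ θ, fourier n θ ∂ν := by
    intro n
    obtain ⟨j, rfl | rfl⟩ := n.eq_nat_or_neg
    · have := congrArg conj (hneg j)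
      simpa only [← integral_conj, ← fourier_neg, neg_neg] using this
    · exact hneg j
  have hcont : ∀ (ρ : Measure Angle) [IsFiniteMeasure ρ],
      Continuous fun f : C(Angle, ℂ) => ∫ θ, f θ ∂ρ := by
    intro ρ _
    refine LipschitzWith.continuous (K := (ρ Set.univ).toNNReal) (LipschitzWith.of_dist_le_mul ?_)
    intro f g
    rw [dist_eq_norm, dist_eq_norm, ← integral_sub (integrable_of_continuous ρ f.continuous)
      (integrable_of_continuous ρ g.continuous)]
    refine (norm_integral_le_of_norm_le_const (.of_forall fun θ => ?_)).trans_eq (mul_comm _ _)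
    exact (f - g).norm_coe_le_norm θ
  have hall : ∀ f : C(Angle, ℂ), ∫ θ, f θ ∂μ = ∫ θ, f θ ∂ν := by
    intro f
    have hf : f ∈ (Submodule.span ℂ (Set.range <| @fourier (2 * Real.pi))).topologicalClosure := by
      rw [span_fourier_closure_eq_top]
      trivial
    refine closure_minimal (s := (Submodule.span ℂ (Set.range (@fourier (2 * Real.pi))) :
      Set C(Angle, ℂ))) (t := {f : C(Angle, ℂ) | ∫ θ, f θ ∂μ = ∫ θ, f θ ∂ν}) ?_
      (isClosed_eq (hcont μ) (hcont ν)) hf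
    intro g hg
    induction hg using Submodule.span_induction with
    | mem g hg => obtain ⟨n, rfl⟩ := hg; exact hfour n
    | zero => simp
    | add g₁ g₂ _ _ h₁ h₂ =>
      simp only [Set.mem_ofPred_eq, ContinuousMap.add_apply] at h₁ h₂ ⊢
      rw [integral_add (integrable_of_continuous μ g₁.continuous)
        (integrable_of_continuous μ g₂.continuous),
        integral_add (integrable_of_continuous ν g₁.continuous)
        (integrable_of_continuous ν g₂.continuous), h₁, h₂]
    | smul a g _ hg =>
      simp only [Set.mem_ofPred_eq, ContinuousMap.smul_apply, integral_smul] at hg ⊢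
      rw [hg]
  refine ext_of_forall_integral_eq_of_IsFiniteMeasure fun f => ?_
  have := hall ⟨fun θ => (f θ : ℂ), Complex.continuous_ofReal.comp f.continuous⟩
  simp only [ContinuousMap.coe_mk] at this
  exact_mod_cast this

/-! ### Identification of the weight -/

section Weight

variable {μ : Measure Angle} [IsFiniteMeasure μ] {α : ℕ → ℂ}

theorem IsVerblunsky.integral_conj_pow_mul_limit (h : IsVerblunsky μ α) {S : Angle → ℂ}
    (hS : Continuous S)
    (hlim : TendstoUniformly (fun n θ => (rev n (Phi α n)).eval (pt θ)) S atTop) (j : ℕ) :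
    ∫ θ, conj (pt θ ^ j) * (S θ * conj (S θ)) ∂μ = if j = 0 then ∫ θ, S θ ∂μ else 0 := by
  have h1 : ∀ q : ℂ[X], ∫ θ, conj (q.eval (pt θ)) * S θ ∂μ = conj (q.eval 0) * ∫ θ, S θ ∂μ := by
    intro q
    have ha := tendsto_integral_mul_of_tendstoUniformly μ (fun n => continuous_eval_pt _) hS
      (continuous_conj_eval_pt q) hlim
    have hb := tendsto_integral_mul_of_tendstoUniformly μ (fun n => continuous_eval_pt _) hS
      (continuous_const (y := (1 : ℂ))) hlim
    simp only [one_mul] at hb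
    refine tendsto_nhds_unique (ha.congr' ?_) (hb.const_mul (conj (q.eval 0)))
    filter_upwards [eventually_ge_atTop q.natDegree] with n hn
    exact h.integral_conj_mul_rev_Phi hn
  have h2 : ∀ m, ∫ θ, (conj (pt θ ^ j) * S θ) * conj ((rev m (Phi α m)).eval (pt θ)) ∂μ =
      if j = 0 then ∫ θ, S θ ∂μ else 0 := by
    intro m
    have := h1 (X ^ j * rev m (Phi α m))
    simp only [eval_mul, eval_pow, eval_X, eval_rev_Phi_zero_right, mul_one, map_pow,
      map_zero] at this
    rw [zero_pow_eq, ite_mul, one_mul, zero_mul] at this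
    rw [← this]
    refine integral_congr_ae (.of_forall fun θ => ?_)
    simp only [map_mul, map_pow]
    ring
  have h3 := tendsto_integral_mul_of_tendstoUniformly μ
    (fun m => continuous_conj_eval_pt (rev m (Phi α m))) (Complex.continuous_conj.comp hS)
    ((Complex.continuous_conj.comp (continuous_pt.pow j)).mul hS)
    (Complex.isometry_conj.uniformContinuous.comp_tendstoUniformly hlim)
  have h4 := tendsto_nhds_unique (h3.congr h2) tendsto_const_nhds
  rw [← h4]
  refine integral_congr_ae (.of_forall fun θ => ?_)
  simp only [Function.comp_apply, Pi.mul_apply, Pi.pow_apply]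
  ring

theorem cexp_mul_conj_cexp (w : ℂ) :
    Complex.exp w * conj (Complex.exp w) = ((Real.exp (2 * w.re) : ℝ) : ℂ) := by
  rw [Complex.mul_conj, Complex.normSq_eq_norm_sq, Complex.norm_exp, ← Real.exp_nat_mul]
  norm_num

theorem IsVerblunsky.eq_withDensity [NeZero μ] (h : IsVerblunsky μ α) {f : Angle → ℂ}
    (hf : Continuous f)
    (hlim : TendstoUniformly (fun n θ => (rev n (Phi α n)).eval (pt θ))
      (fun θ => Complex.exp (f θ)) atTop) :
    ∃ c : ℝ, 0 < c ∧
      μ = arc.withDensity fun θ => ENNReal.ofReal (c * Real.exp (-(2 * (f θ).re))) := by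
  have hS : Continuous fun θ => Complex.exp (f θ) := Complex.continuous_exp.comp hf
  have hmom := h.integral_conj_pow_mul_limit hS hlim
  simp only [cexp_mul_conj_cexp] at hmom
  have hg : Continuous fun θ => Real.exp (2 * (f θ).re) :=
    Real.continuous_exp.comp (continuous_const.mul (Complex.continuous_re.comp hf))
  set c : ℝ := ∫ θ, Real.exp (2 * (f θ).re) ∂μ with hc
  have hcS : ∫ θ, Complex.exp (f θ) ∂μ = (c : ℂ) := by
    have := hmom 0
    simp only [pow_zero, map_one, one_mul, if_true] at this
    rw [← this, hc, integral_complex_ofReal]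
  have hc0 : 0 < c := integral_exp_pos (integrable_of_continuous μ hg)
  have hgm : Measurable fun θ => ENNReal.ofReal (Real.exp (2 * (f θ).re)) :=
    hg.measurable.ennreal_ofReal
  have : IsFiniteMeasure (μ.withDensity fun θ => ENNReal.ofReal (Real.exp (2 * (f θ).re))) :=
    isFiniteMeasure_withDensity_ofReal (integrable_of_continuous μ hg).2
  have : IsFiniteMeasure (ENNReal.ofReal c • arc) := Measure.smul_finite _ ENNReal.ofReal_ne_top
  have hmeas : (μ.withDensity fun θ => ENNReal.ofReal (Real.exp (2 * (f θ).re))) =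
      ENNReal.ofReal c • arc := by
    refine measure_ext_of_moments fun j => ?_
    rw [integral_withDensity_eq_integral_toReal_smul hgm (.of_forall fun _ => by simp),
      integral_smul_measure, integral_arc_conj_pow, ENNReal.toReal_ofReal hc0.le]
    have := hmom j
    rw [hcS] at this
    rw [show (c • if j = 0 then (1 : ℂ) else 0) = if j = 0 then (c : ℂ) else 0 by
      split_ifs <;> simp, ← this]
    refine integral_congr_ae (.of_forall fun θ => ?_)
    simp only [ENNReal.toReal_ofReal (Real.exp_pos _).le, Complex.real_smul]
    ring
  refine ⟨c, hc0, ?_⟩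
  have hinv := withDensity_inv_same (μ := μ) hgm
    (.of_forall fun θ => by simp [Real.exp_pos]) (.of_forall fun θ => by simp)
  have hgi : Measurable fun θ => (ENNReal.ofReal (Real.exp (2 * (f θ).re)))⁻¹ := hgm.inv
  rw [hmeas, withDensity_smul_measure, ← withDensity_smul _ hgi] at hinv
  rw [← hinv]
  congr 1
  ext θ
  simp only [Pi.smul_apply, smul_eq_mul]
  rw [← ENNReal.ofReal_inv_of_pos (Real.exp_pos _), ← ENNReal.ofReal_mul hc0.le, Real.exp_neg]

/-- Szegő asymptotics on the closed disc for summable Verblunsky coefficients. -/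
theorem IsVerblunsky.szego_of_summable [NeZero μ] (h : IsVerblunsky μ α) (hα : ∀ n, ‖α n‖ < 1)
    (hs : Summable fun n => ‖α n‖) :
    SzegoCondition μ ∧ TendstoUniformlyOn (fun n z => (rev n (Phi α n)).eval z)
      (fun z => szegoD μ 0 / szegoD μ z) atTop (Metric.ball 0 1) := by
  obtain ⟨F, hF, hF0, hlim⟩ := exists_log_limit_rev_Phi hα hs
  have hFc := continuous_comp_pt hF
  obtain ⟨c, hc, hμ⟩ := h.eq_withDensity (f := fun θ => F (pt θ)) hFc
    (tendstoUniformlyOn_univ.mp ((hlim.comp pt).mono fun θ _ => pt_mem_closedBall θ))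
  have hlc : Continuous fun θ => Real.log c - 2 * (F (pt θ)).re :=
    continuous_const.sub (continuous_const.mul (Complex.continuous_re.comp hFc))
  have hw : ∀ᵐ θ ∂arc, weight μ θ = c * Real.exp (-(2 * (F (pt θ)).re)) := by
    have h1 := Measure.rnDeriv_withDensity arc
      (f := fun θ => ENNReal.ofReal (c * Real.exp (-(2 * (F (pt θ)).re))))
      (Continuous.measurable (continuous_const.mul (Real.continuous_exp.comp
        (continuous_const.mul (Complex.continuous_re.comp hFc)).neg))).ennreal_ofReal
    rw [← hμ] at h1
    filter_upwards [h1] with θ hθ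
    rw [weight, hθ, ENNReal.toReal_ofReal (by positivity)]
  have hlog : ∀ᵐ θ ∂arc, Real.log (weight μ θ) = Real.log c - 2 * (F (pt θ)).re := by
    filter_upwards [hw] with θ hθ
    rw [hθ, Real.log_mul hc.ne' (Real.exp_pos _).ne', Real.log_exp, sub_eq_add_neg]
  have hD : ∀ z : ℂ, ‖z‖ < 1 →
      szegoD μ z = Complex.exp ((Real.log c : ℂ) / 2) * Complex.exp (-F z) := by
    intro z hz
    have h1 : ∫ θ, (pt θ + z) / (pt θ - z) * (Real.log (weight μ θ) : ℂ) ∂arc =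
        ∫ θ, (Real.log c : ℂ) * ((pt θ + z) / (pt θ - z) * 1) -
          (pt θ + z) / (pt θ - z) * (2 * (F (pt θ)).re : ℂ) ∂arc := by
      refine integral_congr_ae ?_
      filter_upwards [hlog] with θ hθ
      rw [hθ]
      push_cast
      ring
    rw [szegoD, h1, integral_sub, integral_const_mul, integral_herglotz_mul_re hF hz,
      integral_herglotz_mul (f := fun _ => 1) diffContOnCl_const hz, hF0, ← Complex.exp_add]
    · congr 1
      simp only [map_zero]
      ring
    · exact integrable_of_continuous _ (continuous_const.mul ((continuous_herglotz hz).mul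
        continuous_const))
    · exact integrable_of_continuous _ ((continuous_herglotz hz).mul (continuous_const.mul
        (Complex.continuous_ofReal.comp (Complex.continuous_re.comp hFc))))
  refine ⟨⟨?_, ?_⟩, (hlim.mono Metric.ball_subset_closedBall).congr_right fun z hz => ?_⟩
  · filter_upwards [hw] with θ hθ
    rw [hθ]
    positivity
  · exact (integrable_of_continuous arc hlc).congr (hlog.mono fun θ hθ => hθ.symm)
  · simp only
    rw [hD z (by simpa using hz), hD 0 (by simp), hF0, neg_zero, Complex.exp_zero, mul_one,
      div_mul_cancel_left₀ (Complex.exp_ne_zero _), ← Complex.exp_neg, neg_neg]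

end Weight

/-! ### Sequences along residue classes -/

theorem tendsto_of_residues {X : Type*} {p : ℕ} (hp : 0 < p) {f : ℕ → X} {l : Filter X}
    (h : ∀ r < p, Tendsto (fun m => f (m * p + r)) atTop l) : Tendsto f atTop l := by
  intro s hs
  have h1 : ∀ᶠ m in atTop, ∀ r ∈ Finset.range p, f (m * p + r) ∈ s :=
    (Finset.eventually_all _).mpr fun r hr => h r (Finset.mem_range.mp hr) hs
  obtain ⟨M, hM⟩ := eventually_atTop.mp h1
  refine mem_map.mpr (mem_atTop_sets.mpr ⟨M * p, fun n hn => ?_⟩)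
  have := hM (n / p) ((Nat.le_div_iff_mul_le hp).mpr hn) (n % p)
    (Finset.mem_range.mpr (Nat.mod_lt n hp))
  rwa [Nat.div_add_mod'] at this

theorem tendsto_mul_add_atTop {p : ℕ} (hp : 0 < p) (r : ℕ) :
    Tendsto (fun m => m * p + r) atTop atTop :=
  tendsto_atTop_mono (fun m => (Nat.le_mul_of_pos_right m hp).trans (Nat.le_add_right _ _))
    tendsto_id

theorem summable_of_residues {p : ℕ} [NeZero p] {f : ℕ → ℝ} (hf : ∀ n, 0 ≤ f n)
    (h : ∀ r : ℕ, Summable fun m => f (m * p + r)) : Summable f := by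
  rw [← (Nat.divModEquiv p).symm.summable_iff]
  refine (summable_prod_of_nonneg (fun _ => hf _)).mpr ⟨fun m => (hasSum_fintype _).summable, ?_⟩
  simp only [tsum_fintype, Nat.divModEquiv_symm_apply]
  exact summable_sum fun r _ => h r

theorem tendsto_zero_of_le_mul_add {y d : ℕ → ℝ} {q : ℝ} (hq0 : 0 ≤ q) (hq1 : q < 1)
    (hy : ∀ m, 0 ≤ y m) (hrec : ∀ m, y (m + 1) ≤ q * y m + d m) (hd : Tendsto d atTop (𝓝 0)) :
    Tendsto y atTop (𝓝 0) := by
  refine tendsto_order.mpr ⟨fun a ha => .of_forall fun m => ha.trans_le (hy m), fun ε hε => ?_⟩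
  have h1 : 0 < (1 - q) * (ε / 2) := by nlinarith
  obtain ⟨M, hM⟩ := eventually_atTop.mp ((tendsto_order.mp hd).2 _ h1)
  have h2 : ∀ k, y (M + k) ≤ q ^ k * y M + ε / 2 := by
    intro k
    induction k with
    | zero => simp; linarith
    | succ k ih =>
      have h3 := hrec (M + k)
      have h4 := hM (M + k) (Nat.le_add_right _ _)
      have h5 := mul_le_mul_of_nonneg_left ih hq0
      rw [← add_assoc, pow_succ']
      linarith
  have h3 : Tendsto (fun k => q ^ k * y M) atTop (𝓝 0) := by
    simpa using (tendsto_pow_atTop_nhds_zero_of_lt_one hq0 hq1).mul_const (y M)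
  obtain ⟨K, hK⟩ := eventually_atTop.mp ((tendsto_order.mp h3).2 (ε / 2) (by linarith))
  filter_upwards [eventually_ge_atTop (M + K)] with m hm
  have h4 := h2 (m - M)
  have h5 := hK (m - M) (by omega)
  rw [Nat.add_sub_cancel' (by omega)] at h4
  linarith

/-- A perturbed linear recursion with factors `A n` tends to zero if the products of `p`
consecutive factors are uniformly less than one and the perturbations tend to zero. -/
theorem tendsto_zero_of_recursion {x A δ : ℕ → ℝ} {p : ℕ} (hp : 0 < p) {q M : ℝ} (hq0 : 0 ≤ q)
    (hq1 : q < 1) (hx : ∀ n, 0 ≤ x n) (hA0 : ∀ n, 0 ≤ A n) (hAM : ∀ n, A n ≤ M)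
    (hrec : ∀ n, x (n + 1) ≤ A n * x n + δ n) (hδ : Tendsto δ atTop (𝓝 0))
    (hprod : ∀ n, ∏ i ∈ Finset.range p, A (n + i) ≤ q) : Tendsto x atTop (𝓝 0) := by
  have hk : ∀ k, ∃ d : ℕ → ℝ, Tendsto d atTop (𝓝 0) ∧
      ∀ n, x (n + k) ≤ (∏ i ∈ Finset.range k, A (n + i)) * x n + d n := by
    intro k
    induction k with
    | zero => exact ⟨fun _ => 0, tendsto_const_nhds, fun n => by simp⟩
    | succ k ih =>
      obtain ⟨d, hd, hdx⟩ := ih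
      refine ⟨fun n => A (n + k) * d n + δ (n + k), ?_, fun n => ?_⟩
      · have h1 : Tendsto (fun n => A (n + k) * d n) atTop (𝓝 0) := by
          refine squeeze_zero_norm (a := fun n => M * ‖d n‖) (fun n => ?_) ?_
          · rw [norm_mul, Real.norm_of_nonneg (hA0 _)]
            exact mul_le_mul_of_nonneg_right (hAM _) (norm_nonneg _)
          · simpa using hd.norm.const_mul M
        simpa using h1.add (hδ.comp (tendsto_add_atTop_nat k))
      · have h1 := hrec (n + k)
        have h2 := mul_le_mul_of_nonneg_left (hdx n) (hA0 (n + k))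
        rw [Finset.prod_range_succ, ← add_assoc]
        linarith
  obtain ⟨d, hd, hdx⟩ := hk p
  refine tendsto_of_residues hp fun r _ => ?_
  refine tendsto_zero_of_le_mul_add hq0 hq1 (fun m => hx _) (fun m => ?_)
    (hd.comp (tendsto_mul_add_atTop hp r))
  have h1 := hdx (m * p + r)
  have h2 := mul_le_mul_of_nonneg_right (hprod (m * p + r)) (hx (m * p + r))
  rw [show (m + 1) * p + r = m * p + r + p by ring]
  simp only [Function.comp_apply]
  linarith

theorem exists_bound_of_tendstoUniformlyOn {X : Type*} {F : ℕ → X → ℂ} {f : X → ℂ} {s : Set X}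
    (h : TendstoUniformlyOn F f atTop s) :
    ∃ η : ℕ → ℝ, Tendsto η atTop (𝓝 0) ∧ ∀ᶠ n in atTop, ∀ z ∈ s, ‖F n z - f z‖ ≤ η n := by
  have hle : ∀ ε : ℝ, 0 < ε → ∀ᶠ n in atTop, ⨆ z ∈ s, ‖F n z - f z‖ₑ ≤ ENNReal.ofReal ε := by
    intro ε hε
    filter_upwards [Metric.tendstoUniformlyOn_iff.mp h ε hε] with n hn
    refine iSup₂_le fun z hz => ?_
    rw [← ofReal_norm, ← dist_eq_norm, dist_comm]
    exact ENNReal.ofReal_le_ofReal (hn z hz).le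
  refine ⟨fun n => (⨆ z ∈ s, ‖F n z - f z‖ₑ).toReal, ?_, ?_⟩
  · refine tendsto_order.mpr ⟨fun a ha => .of_forall fun n => ha.trans_le ENNReal.toReal_nonneg,
      fun ε hε => ?_⟩
    filter_upwards [hle (ε / 2) (by linarith)] with n hn
    have := ENNReal.toReal_mono ENNReal.ofReal_ne_top hn
    rw [ENNReal.toReal_ofReal (by linarith)] at this
    linarith
  · filter_upwards [hle 1 one_pos] with n hn z hz
    rw [← toReal_enorm]
    exact ENNReal.toReal_mono (ne_top_of_le_ne_top ENNReal.ofReal_ne_top hn)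
      (le_iSup₂ (f := fun z _ => ‖F n z - f z‖ₑ) z hz)

/-- A sequence of functions satisfying a perturbed linear recursion, uniformly on a set, tends to
zero uniformly on that set. -/
theorem tendstoUniformlyOn_zero_of_recursion {X : Type*} {s : Set X} {e : ℕ → X → ℂ}
    {A δ : ℕ → ℝ} {p : ℕ} (hp : 0 < p) {q M : ℝ} (hq0 : 0 ≤ q) (hq1 : q < 1)
    (hA0 : ∀ n, 0 ≤ A n) (hAM : ∀ᶠ n in atTop, A n ≤ M)
    (hrec : ∀ᶠ n in atTop, ∀ z ∈ s, ‖e (n + 1) z‖ ≤ A n * ‖e n z‖ + δ n)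
    (hbdd : ∀ n, ∃ B, ∀ z ∈ s, ‖e n z‖ ≤ B)
    (hδ : Tendsto δ atTop (𝓝 0))
    (hprod : ∀ᶠ n in atTop, ∏ i ∈ Finset.range p, A (n + i) ≤ q) :
    TendstoUniformlyOn e (fun _ => 0) atTop s := by
  obtain ⟨N, hN⟩ := eventually_atTop.mp (hAM.and (hrec.and hprod))
  obtain ⟨B, hB⟩ := hbdd N
  let x : ℕ → ℝ := fun k =>
    Nat.rec (max B 0) (fun k y => A (N + k) * y + |δ (N + k)|) k
  have hxs : ∀ k, x (k + 1) = A (N + k) * x k + |δ (N + k)| := fun k => rfl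
  have hx0 : ∀ k, 0 ≤ x k := by
    intro k
    induction k with
    | zero => exact le_max_right _ _
    | succ k ih => rw [hxs]; exact add_nonneg (mul_nonneg (hA0 _) ih) (abs_nonneg _)
  have hex : ∀ k, ∀ z ∈ s, ‖e (N + k) z‖ ≤ x k := by
    intro k z hz
    induction k with
    | zero => exact (hB z hz).trans (le_max_left _ _)
    | succ k ih =>
      have h1 := (hN (N + k) (Nat.le_add_right _ _)).2.1 z hz
      rw [hxs, ← add_assoc]
      exact h1.trans (add_le_add (mul_le_mul_of_nonneg_left ih (hA0 _)) (le_abs_self _))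
  have hshift : Tendsto (fun k => N + k) atTop atTop := by
    simpa only [add_comm] using tendsto_add_atTop_nat N
  have hlim : Tendsto x atTop (𝓝 0) := by
    refine tendsto_zero_of_recursion (A := fun k => A (N + k)) (δ := fun k => |δ (N + k)|) hp hq0
      hq1 hx0 (fun k => hA0 _) (fun k => (hN (N + k) (Nat.le_add_right _ _)).1)
      (fun k => (hxs k).le) ?_ (fun k => ?_)
    · simpa using (hδ.comp hshift).abs
    · simp_rw [← add_assoc]
      exact (hN (N + k) (Nat.le_add_right _ _)).2.2
  rw [Metric.tendstoUniformlyOn_iff]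
  intro ε hε
  obtain ⟨K, hK⟩ := eventually_atTop.mp ((tendsto_order.mp hlim).2 ε hε)
  filter_upwards [eventually_ge_atTop (N + K)] with n hn z hz
  have h1 := hex (n - N) z hz
  rw [Nat.add_sub_cancel' (by omega)] at h1
  rw [dist_zero_left]
  exact h1.trans_lt (hK (n - N) (by omega))

/-! ### Coefficients with asymptotically periodic ratios -/

theorem prod_range_natCast_zmod {M : Type*} [CommMonoid M] (p : ℕ) [NeZero p] (f : ZMod p → M) :
    ∏ i ∈ Finset.range p, f (i : ZMod p) = ∏ j, f j := by
  refine Finset.prod_bij' (fun i _ => (i : ZMod p)) (fun j _ => j.val) (fun _ _ => Finset.mem_univ _)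
    (fun j _ => Finset.mem_range.mpr j.val_lt) (fun i hi => ?_) (fun j _ => ?_) (fun _ _ => rfl)
  · exact ZMod.val_cast_of_lt (Finset.mem_range.mp hi)
  · exact ZMod.natCast_zmod_val j

/-- The limit `(b * conj (c a))⁻¹` of the conjugated inverse ratios of coefficients along a residue
class. -/
noncomputable def invRatio {p : ℕ} (b : ℝ) (c : ZMod p → ℂ) (a : ZMod p) : ℂ :=
  ((b : ℂ) * conj (c a))⁻¹

section Ratio

variable {p : ℕ} [NeZero p] {b : ℝ} {c : ZMod p → ℂ} {α : ℕ → ℂ}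

theorem apply_ne_zero_of_prod_eq_one (hc : ∏ j, c j = 1) (a : ZMod p) : c a ≠ 0 := by
  have : ∏ j, c j ≠ 0 := by rw [hc]; exact one_ne_zero
  exact Finset.prod_ne_zero_iff.mp this a (Finset.mem_univ a)

theorem tendsto_ratio (h : ∀ ℓ ∈ Finset.Icc 1 p,
      Tendsto (fun m : ℕ => α (m * p + ℓ) / α (m * p + ℓ - 1)) atTop
        (𝓝 ((b : ℂ) * c (ℓ : ZMod p)))) (k : ℕ) :
    Tendsto (fun m : ℕ => α (m * p + k + 1) / α (m * p + k)) atTop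
      (𝓝 ((b : ℂ) * c ((k + 1 : ℕ) : ZMod p))) := by
  have hp : 0 < p := Nat.pos_of_neZero p
  have h1 := h (k % p + 1) (Finset.mem_Icc.mpr ⟨by omega, Nat.mod_lt k hp⟩)
  have h2 : ((k % p + 1 : ℕ) : ZMod p) = ((k + 1 : ℕ) : ZMod p) := by simp
  rw [h2] at h1
  refine (h1.comp (tendsto_add_atTop_nat (k / p))).congr fun m => ?_
  have h3 : (m + k / p) * p + (k % p + 1) = m * p + k + 1 := by
    rw [add_mul, ← add_assoc, add_assoc (m * p), Nat.div_add_mod']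
  simp only [Function.comp_apply, h3, Nat.add_sub_cancel]

variable (h : ∀ k : ℕ, Tendsto (fun m : ℕ => α (m * p + k + 1) / α (m * p + k)) atTop
      (𝓝 ((b : ℂ) * c ((k + 1 : ℕ) : ZMod p))))

include h

theorem eventually_ne_zero_of_ratio (hb : b ≠ 0) (hc : ∏ j, c j = 1) :
    ∀ᶠ n in atTop, α n ≠ 0 := by
  suffices Tendsto (fun n => n) atTop (𝓟 {n | α n ≠ 0}) from tendsto_principal.mp this
  refine tendsto_of_residues (Nat.pos_of_neZero p) fun r _ => tendsto_principal.mpr ?_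
  have h0 : (b : ℂ) * c ((r + 1 : ℕ) : ZMod p) ≠ 0 :=
    mul_ne_zero (Complex.ofReal_ne_zero.mpr hb) (apply_ne_zero_of_prod_eq_one hc _)
  filter_upwards [(h r).eventually_ne h0] with m hm h1
  exact hm (by rw [h1, div_zero])

theorem tendsto_conj_ratio_sub_invRatio (hb : b ≠ 0) (hc : ∏ j, c j = 1) :
    Tendsto (fun n : ℕ => conj (α n) / conj (α (n + 1)) - invRatio b c ((n + 1 : ℕ) : ZMod p))
      atTop (𝓝 0) := by
  refine tendsto_of_residues (Nat.pos_of_neZero p) fun r _ => ?_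
  have h0 : (b : ℂ) * c ((r + 1 : ℕ) : ZMod p) ≠ 0 :=
    mul_ne_zero (Complex.ofReal_ne_zero.mpr hb) (apply_ne_zero_of_prod_eq_one hc _)
  have h1 := ((Complex.continuous_conj.tendsto _).comp ((h r).inv₀ h0)).sub_const
    (invRatio b c ((r + 1 : ℕ) : ZMod p))
  have h2 : conj ((b : ℂ) * c ((r + 1 : ℕ) : ZMod p))⁻¹ - invRatio b c ((r + 1 : ℕ) : ZMod p) =
      0 := by
    simp [invRatio]
  rw [h2] at h1
  refine h1.congr fun m => ?_
  simp

theorem tendsto_norm_period_ratio (hb : 0 < b) (hc : ∏ j, c j = 1) :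
    Tendsto (fun n : ℕ => ‖α (n + p)‖ / ‖α n‖) atTop (𝓝 (b ^ p)) := by
  have hne := eventually_ne_zero_of_ratio h hb.ne' hc
  refine tendsto_of_residues (Nat.pos_of_neZero p) fun r _ => ?_
  have h1 := (tendsto_finsetProd (Finset.range p) fun i _ => h (r + i)).norm
  have h2 : ∏ i ∈ Finset.range p, (b : ℂ) * c ((r + i + 1 : ℕ) : ZMod p) = (b : ℂ) ^ p := by
    rw [Finset.prod_mul_distrib, Finset.prod_const, Finset.card_range]
    have h3 := prod_range_natCast_zmod p fun j => c (Equiv.addRight ((r : ZMod p) + 1) j)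
    rw [Equiv.prod_comp, hc] at h3
    have h4 : ∏ i ∈ Finset.range p, c ((r + i + 1 : ℕ) : ZMod p) = 1 := by
      rw [← h3]
      refine Finset.prod_congr rfl fun i _ => ?_
      congr 1
      simp only [Equiv.coe_addRight]
      push_cast
      ring
    rw [h4, mul_one]
  rw [h2, norm_pow, Complex.norm_real, Real.norm_of_nonneg hb.le] at h1
  obtain ⟨N, hN⟩ := eventually_atTop.mp hne
  refine h1.congr' ?_
  filter_upwards [(tendsto_mul_add_atTop (Nat.pos_of_neZero p) r).eventually_ge_atTop N] with m hm
  have h5 : ∀ k, ∏ i ∈ Finset.range k, α (m * p + (r + i) + 1) / α (m * p + (r + i)) =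
      α (m * p + r + k) / α (m * p + r) := by
    intro k
    induction k with
    | zero => simp [hN _ hm]
    | succ k ih =>
      have h6 := hN (m * p + r + k) (by omega)
      rw [Finset.prod_range_succ, ih, ← add_assoc (m * p), div_mul_div_comm, mul_comm,
        mul_div_mul_right _ _ h6, add_assoc _ k 1]
  rw [h5, norm_div]

theorem summable_norm_of_ratio (hb : 0 < b) (hb1 : b < 1) (hc : ∏ j, c j = 1) :
    Summable fun n => ‖α n‖ := by
  refine summable_of_residues (p := p) (fun _ => norm_nonneg _) fun r => ?_
  have hp := Nat.pos_of_neZero p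
  refine summable_of_ratio_test_tendsto_lt_one (l := b ^ p)
    (pow_lt_one₀ hb.le hb1 hp.ne') ?_ ?_
  · filter_upwards [(tendsto_mul_add_atTop hp r).eventually
      (eventually_ne_zero_of_ratio h hb.ne' hc)] with m hm
    exact norm_ne_zero_iff.mpr hm
  · refine ((tendsto_norm_period_ratio h hb hc).comp (tendsto_mul_add_atTop hp r)).congr fun m => ?_
    simp only [Function.comp_apply, norm_norm]
    rw [show (m + 1) * p + r = m * p + r + p by ring]

end Ratio

section LimitFunction

variable {p : ℕ} [NeZero p] {b : ℝ} {c : ZMod p → ℂ}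

theorem G_succ (hc : ∏ j, c j = 1) (ℓ : ℕ) {z : ℂ}
    (hz : 1 - z ^ p / (b : ℂ) ^ p ≠ 0) :
    G p b c (ℓ + 1) z = 1 + z * invRatio b c (ℓ : ZMod p) * G p b c ℓ z := by
  have hprod : ∏ j ∈ Finset.range p, invRatio b c ((ℓ : ZMod p) - (j : ZMod p)) =
      ((b : ℂ) ^ p)⁻¹ := by
    rw [prod_range_natCast_zmod p fun j => invRatio b c ((ℓ : ZMod p) - j)]
    have h1 := Equiv.prod_comp (Equiv.subLeft (ℓ : ZMod p)) (invRatio b c)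
    simp only [Equiv.subLeft_apply] at h1
    rw [h1]
    simp only [invRatio]
    rw [Finset.prod_inv_distrib, Finset.prod_mul_distrib, ← map_prod, hc]
    simp
  have hterm : ∀ k : ℕ, ∏ j ∈ Finset.Icc 1 (k + 1),
      ((b : ℂ) * conj (c (((ℓ + 1 : ℕ) : ZMod p) - (j : ZMod p))))⁻¹ =
      invRatio b c (ℓ : ZMod p) *
        ∏ j ∈ Finset.Icc 1 k, ((b : ℂ) * conj (c ((ℓ : ZMod p) - (j : ZMod p))))⁻¹ := by
    intro k
    have h1 : ∀ n : ℕ, Finset.Icc 1 n = Finset.Ico 1 (n + 1) := fun n => by ext; simp [Finset.mem_Ico]; try omega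
    rw [h1, h1, Finset.prod_Ico_eq_prod_range, Finset.prod_Ico_eq_prod_range,
      Nat.add_sub_cancel, Nat.add_sub_cancel, Finset.prod_range_succ', mul_comm]
    congr 1
    · simp [invRatio]
    · refine Finset.prod_congr rfl fun j _ => ?_
      congr 4
      push_cast
      abel
  have hlast : invRatio b c (ℓ : ZMod p) * ∏ j ∈ Finset.Icc 1 (p - 1),
      ((b : ℂ) * conj (c ((ℓ : ZMod p) - (j : ZMod p))))⁻¹ = ((b : ℂ) ^ p)⁻¹ := by
    obtain ⟨k, rfl⟩ := Nat.exists_eq_succ_of_ne_zero (NeZero.ne p)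
    have h1 : Finset.Icc 1 k = Finset.Ico 1 (k + 1) := by ext; simp [Finset.mem_Ico]; try omega
    rw [← hprod, Nat.succ_sub_one, Finset.prod_range_succ', h1, Finset.prod_Ico_eq_prod_range,
      mul_comm, Nat.add_sub_cancel]
    congr 1
    · exact Finset.prod_congr rfl fun j _ => by simp only [invRatio, add_comm 1 j]
    · simp
  have hnum : ∑ k ∈ Finset.range p, (∏ j ∈ Finset.Icc 1 k,
        ((b : ℂ) * conj (c (((ℓ + 1 : ℕ) : ZMod p) - (j : ZMod p))))⁻¹) * z ^ k =
      1 - z ^ p / (b : ℂ) ^ p + z * invRatio b c (ℓ : ZMod p) *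
        ∑ k ∈ Finset.range p, (∏ j ∈ Finset.Icc 1 k,
          ((b : ℂ) * conj (c ((ℓ : ZMod p) - (j : ZMod p))))⁻¹) * z ^ k := by
    obtain ⟨k, hk⟩ := Nat.exists_eq_succ_of_ne_zero (NeZero.ne p)
    have hpk : p - 1 = k := by omega
    rw [hpk] at hlast
    rw [show Finset.range p = Finset.range (k + 1) from congrArg _ hk]
    rw [Finset.sum_range_succ', Finset.sum_range_succ]
    simp only [hterm]
    rw [div_eq_mul_inv, ← hlast, mul_add, Finset.mul_sum]
    have h2 : z ^ p = z * z ^ k := by rw [hk, pow_succ']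
    rw [h2]
    simp only [pow_zero, mul_one]
    have h3 : ∀ i : ℕ, invRatio b c (ℓ : ZMod p) * (∏ j ∈ Finset.Icc 1 i,
        ((b : ℂ) * conj (c ((ℓ : ZMod p) - (j : ZMod p))))⁻¹) * z ^ (i + 1) =
        z * invRatio b c (ℓ : ZMod p) * ((∏ j ∈ Finset.Icc 1 i,
        ((b : ℂ) * conj (c ((ℓ : ZMod p) - (j : ZMod p))))⁻¹) * z ^ i) := fun i => by ring
    simp only [h3]
    simp
    ring
  unfold G
  rw [hnum, add_div, div_self hz, mul_div_assoc]

omit [NeZero p] in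
theorem G_natCast_congr {m n : ℕ} (h : (m : ZMod p) = n) : G p b c m = G p b c n := by
  funext z
  simp only [G, h]

theorem one_sub_pow_div_ne_zero (hb : 0 < b) {z : ℂ} (hz : ‖z‖ < b) :
    1 - z ^ p / (b : ℂ) ^ p ≠ 0 := by
  intro h
  have h1 : ‖z ^ p / (b : ℂ) ^ p‖ = 1 := by rw [← sub_eq_zero.mp h, norm_one]
  rw [norm_div, norm_pow, norm_pow, Complex.norm_real, Real.norm_of_nonneg hb.le,
    ← div_pow] at h1
  have h2 : (‖z‖ / b) ^ p < 1 :=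
    pow_lt_one₀ (by positivity) ((div_lt_one hb).mpr hz) (NeZero.ne p)
  linarith

theorem exists_bound_G (hb : 0 < b) {R : ℝ} (hR : R < b) :
    ∃ K, 0 ≤ K ∧ ∀ n : ℕ, ∀ z ∈ Metric.ball (0 : ℂ) R, ‖G p b c n z‖ ≤ K := by
  have h1 : ∀ r : ℕ, ∃ K, ∀ z ∈ Metric.closedBall (0 : ℂ) R, ‖G p b c r z‖ ≤ K := by
    intro r
    refine (isCompact_closedBall (0 : ℂ) R).exists_bound_of_continuousOn ?_
    refine ContinuousOn.div (by fun_prop) (by fun_prop) fun z hz => ?_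
    exact one_sub_pow_div_ne_zero hb ((mem_closedBall_zero_iff.mp hz).trans_lt hR)
  choose K hK using h1
  refine ⟨∑ r ∈ Finset.range p, |K r|, Finset.sum_nonneg fun _ _ => abs_nonneg _, fun n z hz => ?_⟩
  rw [← G_natCast_congr (m := n % p) (n := n) (by simp)]
  refine (hK _ z (Metric.ball_subset_closedBall hz)).trans ((le_abs_self _).trans ?_)
  exact Finset.single_le_sum (f := fun r => |K r|) (fun _ _ => abs_nonneg _)
    (Finset.mem_range.mpr (Nat.mod_lt n (Nat.pos_of_neZero p)))

end LimitFunction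

/-- Ratio asymptotics of the orthogonal polynomials inside the disc of radius `b`. -/
theorem tendstoUniformlyOn_Phi_div_of_ratio {p : ℕ} [NeZero p] {b : ℝ} {c : ZMod p → ℂ}
    {α : ℕ → ℂ} (h : ∀ k : ℕ, Tendsto (fun m : ℕ => α (m * p + k + 1) / α (m * p + k)) atTop
      (𝓝 ((b : ℂ) * c ((k + 1 : ℕ) : ZMod p)))) (hb : 0 < b) (hc : ∏ j, c j = 1) {S : ℂ → ℂ}
    {R : ℝ} (hR0 : 0 < R) (hR : R < b) (hSb : ∃ B, ∀ z ∈ Metric.ball (0 : ℂ) R, ‖S z‖ ≤ B)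
    (hS : TendstoUniformlyOn (fun n z => (rev n (Phi α n)).eval z) S atTop (Metric.ball 0 R)) :
    TendstoUniformlyOn (fun n z => (Phi α (n + 1)).eval z / conj (α n) -
      -(S z * G p b c (n + 1) z)) (fun _ => 0) atTop (Metric.ball 0 R) := by
  have hp := Nat.pos_of_neZero p
  have hne := eventually_ne_zero_of_ratio h hb.ne' hc
  have hr := tendsto_conj_ratio_sub_invRatio h hb.ne' hc
  obtain ⟨B, hB⟩ := hSb
  obtain ⟨K, hK0, hK⟩ := exists_bound_G (p := p) (c := c) hb hR
  obtain ⟨η, hη, hηS⟩ := exists_bound_of_tendstoUniformlyOn hS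
  have hmem : ∀ {z : ℂ}, z ∈ Metric.ball (0 : ℂ) R → ‖z‖ < R := fun h => by simpa using h
  have hB0 : 0 ≤ B := (norm_nonneg _).trans (hB 0 (Metric.mem_ball_self hR0))
  have hg : ∀ n : ℕ, ∀ z ∈ Metric.ball (0 : ℂ) R, ‖-(S z * G p b c n z)‖ ≤ B * K := by
    intro n z hz
    rw [norm_neg, norm_mul]
    exact mul_le_mul (hB z hz) (hK n z hz) (norm_nonneg _) hB0
  set r : ℕ → ℂ := fun n => conj (α n) / conj (α (n + 1)) with hrdef
  set ρ : ℕ → ℂ := fun n => invRatio b c ((n + 1 : ℕ) : ZMod p) with hρdef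
  have hρ : ∀ n, ‖ρ n‖ ≤ ∑ a, ‖invRatio b c a‖ := fun n =>
    Finset.single_le_sum (f := fun a => ‖invRatio b c a‖) (fun _ _ => norm_nonneg _)
      (Finset.mem_univ _)
  obtain ⟨q, hq, hq1⟩ := exists_between
    (show (R / b) ^ p < 1 from pow_lt_one₀ (by positivity) ((div_lt_one hb).mpr hR) hp.ne')
  have hq0 : 0 ≤ q := le_trans (by positivity) hq.le
  refine tendstoUniformlyOn_zero_of_recursion (A := fun n => R * ‖r n‖)
    (δ := fun n => R * ‖r n - ρ n‖ * (B * K) + η (n + 1)) (q := q)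
    (M := R * (∑ a, ‖invRatio b c a‖ + 1)) hp hq0 hq1 (fun n => by positivity) ?_ ?_ ?_ ?_ ?_
  · filter_upwards [(tendsto_order.mp hr.norm).2 1 (by simp)] with n hn
    have h1 : ‖r n‖ ≤ ‖r n - ρ n‖ + ‖ρ n‖ := by
      simpa using norm_add_le (r n - ρ n) (ρ n)
    have h2 : ‖r n - ρ n‖ < 1 := hn
    have h3 := hρ n
    exact mul_le_mul_of_nonneg_left (by linarith) hR0.le
  · filter_upwards [hne, (tendsto_add_atTop_nat 1).eventually hne,
      (tendsto_add_atTop_nat 1).eventually hηS] with n h1 h2 h3 z hz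
    have hz1 := (hmem hz).le
    have hkey : (Phi α (n + 1 + 1)).eval z / conj (α (n + 1)) - -(S z * G p b c (n + 1 + 1) z) =
        z * r n * ((Phi α (n + 1)).eval z / conj (α n) - -(S z * G p b c (n + 1) z)) +
        (z * (r n - ρ n) * -(S z * G p b c (n + 1) z) -
          ((rev (n + 1) (Phi α (n + 1))).eval z - S z)) := by
      have h4 : conj (α n) ≠ 0 := (_root_.map_ne_zero _).mpr h1
      have h5 : conj (α (n + 1)) ≠ 0 := (_root_.map_ne_zero _).mpr h2
      rw [eval_Phi_succ, G_succ hc _ (one_sub_pow_div_ne_zero hb ((hmem hz).trans hR))]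
      simp only [hrdef, hρdef]
      field_simp
      ring
    rw [hkey]
    refine (norm_add_le _ _).trans (add_le_add ?_ ((norm_sub_le _ _).trans (add_le_add ?_ ?_)))
    · rw [norm_mul, norm_mul]
      gcongr
    · rw [norm_mul, norm_mul]
      exact mul_le_mul (by gcongr) (hg _ z hz) (norm_nonneg _) (by positivity)
    · exact h3 z hz
  · intro n
    obtain ⟨C, hC⟩ := (isCompact_closedBall (0 : ℂ) R).exists_bound_of_continuousOn
      (f := fun z => (Phi α (n + 1)).eval z / conj (α n))
      ((Phi α (n + 1)).continuous.div_const _).continuousOn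
    refine ⟨C + B * K, fun z hz => (norm_sub_le _ _).trans (add_le_add ?_ (hg _ z hz))⟩
    exact hC z (Metric.ball_subset_closedBall hz)
  · have h1 := ((hr.norm.const_mul R).mul_const (B * K)).add (hη.comp (tendsto_add_atTop_nat 1))
    have h2 : R * ‖(0 : ℂ)‖ * (B * K) + 0 = 0 := by simp
    rw [h2] at h1
    exact h1
  · have h1 := ((tendsto_norm_period_ratio h hb hc).inv₀ (by positivity)).const_mul (R ^ p)
    rw [← div_eq_mul_inv, ← div_pow] at h1
    obtain ⟨N, hN⟩ := eventually_atTop.mp hne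
    filter_upwards [(tendsto_order.mp h1).2 q hq, eventually_ge_atTop N] with n hn hnN
    have h2 : ∀ k, ∏ i ∈ Finset.range k, R * ‖r (n + i)‖ = R ^ k * (‖α (n + k)‖ / ‖α n‖)⁻¹ := by
      intro k
      induction k with
      | zero => simp [hN n hnN]
      | succ k ih =>
        have h3 : ‖α (n + k)‖ ≠ 0 := norm_ne_zero_iff.mpr (hN _ (by omega))
        have h4 : ‖α (n + k + 1)‖ ≠ 0 := norm_ne_zero_iff.mpr (hN _ (by omega))
        have h5 : ‖α n‖ ≠ 0 := norm_ne_zero_iff.mpr (hN _ (by omega))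
        rw [Finset.prod_range_succ, ih]
        simp only [hrdef, norm_div, RCLike.norm_conj, ← add_assoc]
        field_simp
        rw [pow_succ]
    rw [h2]
    exact hn.le

end OPUC

theorem corollary2p5 (μ : Measure OPUC.Angle) [IsProbabilityMeasure μ]
    (hμ : OPUC.IsNontrivial μ) (α : ℕ → ℂ) (hα : OPUC.IsVerblunsky μ α)
    (b : ℝ) (hb0 : 0 < b) (hb1 : b < 1) (p : ℕ) [NeZero p] (c : ZMod p → ℂ)
    (hc : ∏ j, c j = 1)
    (hratio : ∀ ℓ ∈ Finset.Icc 1 p,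
      Tendsto (fun m : ℕ => α (m * p + ℓ) / α (m * p + ℓ - 1)) atTop
        (𝓝 ((b : ℂ) * c (ℓ : ZMod p)))) :
    OPUC.SzegoCondition μ ∧
    ∀ ℓ ∈ Finset.Icc 1 p, ∀ ε : ℝ, 0 < ε →
      TendstoUniformlyOn
        (fun (m : ℕ) (z : ℂ) =>
          (OPUC.Phi α (m * p + ℓ)).eval z / conj (α (m * p + ℓ - 1)))
        (fun z : ℂ => -(OPUC.szegoD μ 0 / OPUC.szegoD μ z * OPUC.G p b c ℓ z))
        atTop {z : ℂ | ‖z‖ < b - ε} := by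
  have h := OPUC.tendsto_ratio hratio
  obtain ⟨hSz, hlim⟩ := hα.szego_of_summable (hα.norm_lt_one hμ)
    (OPUC.summable_norm_of_ratio h hb0 hb1 hc)
  refine ⟨hSz, fun ℓ hℓ ε hε => ?_⟩
  have hset : {z : ℂ | ‖z‖ < b - ε} = Metric.ball 0 (b - ε) := by ext; simp
  rw [hset]
  rcases le_or_gt (b - ε) 0 with hR | hR
  · rw [Metric.ball_eq_empty.mpr hR]
    exact tendstoUniformlyOn_empty
  have hlimR := hlim.mono (Metric.ball_subset_ball (show b - ε ≤ 1 by linarith))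
  have hbdd : ∃ B, ∀ z ∈ Metric.ball (0 : ℂ) (b - ε), ‖OPUC.szegoD μ 0 / OPUC.szegoD μ z‖ ≤ B := by
    obtain ⟨n, hn⟩ := (Metric.tendstoUniformlyOn_iff.mp hlimR 1 one_pos).exists
    obtain ⟨C, hC⟩ := (isCompact_closedBall (0 : ℂ) (b - ε)).exists_bound_of_continuousOn
      (OPUC.rev n (OPUC.Phi α n)).continuous.continuousOn
    refine ⟨1 + C, fun z hz => ?_⟩
    have h1 := (hn z hz).le
    rw [dist_eq_norm] at h1
    have h2 := norm_add_le (OPUC.szegoD μ 0 / OPUC.szegoD μ z -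
      (OPUC.rev n (OPUC.Phi α n)).eval z) ((OPUC.rev n (OPUC.Phi α n)).eval z)
    rw [sub_add_cancel] at h2
    exact h2.trans (add_le_add h1 (hC z (Metric.ball_subset_closedBall hz)))
  have hmain := OPUC.tendstoUniformlyOn_Phi_div_of_ratio h hb0 hc hR (by linarith) hbdd hlimR
  rw [Metric.tendstoUniformlyOn_iff] at hmain ⊢
  intro δ hδ
  filter_upwards [(OPUC.tendsto_mul_add_atTop (Nat.pos_of_neZero p) (ℓ - 1)).eventually
    (hmain δ hδ)] with m hm z hz
  have hℓ1 := (Finset.mem_Icc.mp hℓ).1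
  have h1 := hm z hz
  have h2 : m * p + (ℓ - 1) + 1 = m * p + ℓ := by omega
  have h3 : m * p + (ℓ - 1) = m * p + ℓ - 1 := by omega
  rw [dist_zero_left, h2, h3, OPUC.G_natCast_congr (n := ℓ) (by simp)] at h1
  rwa [dist_comm, dist_eq_norm]
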